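/- Let $0<\xi<\pi$ and let $S=\{(r\cos\theta,r\sin\theta): r\ge 0,\ 0\le\theta\le\xi\}\subset\mathbb{R}^2$ be the closed wedge of angle $\xi$ with vertex at the origin and one side along the positive horizontal half-line; let $S^0$ be its interior. Let $B=(B_t)_{t\ge 0}$ be a standard two-dimensional Brownian motion (zero drift, started at the origin, almost surely continuous paths) under a probability measure $P$, and let $\mu\in\mathbb{R}^2$, $\mu\neq 0$, be of the form $\mu=\|\mu\|(\cos\eta,\sin\eta)$ with $\eta\in(0,\xi)$. Then for each $z\in S^0$, the event $\{z+B_t+\mu t\in S^0 \text{ for all } t\ge 0\}$ is measurable (up to a $P$-null set) and $$P\big(z+B_t+\mu t\in S^0 \text{ for all } t\ge 0\big)>0 .$$ -/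

import Mathlib

open MeasureTheory ProbabilityTheory
open scoped NNReal

/-- The planar wedge of angle `ξ` with vertex at the origin and one side along the positive
horizontal half-line, given in polar coordinates by `r ≥ 0` and `0 ≤ θ ≤ ξ`. -/
def wedge (ξ : ℝ) : Set (EuclideanSpace ℝ (Fin 2)) :=
  {x | ∃ r θ : ℝ, 0 ≤ r ∧ 0 ≤ θ ∧ θ ≤ ξ ∧ x = !₂[r * Real.cos θ, r * Real.sin θ]}

/-- A standard driftless `d`-dimensional Brownian motion started at the origin: its coordinate
processes are standard one-dimensional Brownian motions (almost surely continuous and started at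
`0`), and these processes are independent of each other. -/
structure IsStandardBrownianMotion {Ω : Type*} [MeasurableSpace Ω] {d : ℕ}
    (B : ℝ≥0 → Ω → EuclideanSpace ℝ (Fin d)) (P : Measure Ω) : Prop where
  isBrownianReal_coord : ∀ i : Fin d, IsBrownianReal (fun t ω ↦ B t ω i) P
  iIndepFun_coord : iIndepFun (fun (i : Fin d) (ω : Ω) (t : ℝ≥0) ↦ B t ω i) P

/-!
The wedge is a closed convex cone `K` with nonempty interior, and the drift `μ` is interior to it.
The argument works for any such cone in any dimension. For a starting point `w`, write `p w` for the
probability that `w + B t + t • μ` stays in `K`.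

* Almost surely `‖B t‖ ≤ M + c * t` for all `t`, with `c` as small as desired and `M` random
  (`ae_exists_norm_le_add_mul`); this is the strong law `B t / t → 0`, obtained from time inversion.
  If the closed ball of radius `c` about `μ` is contained in `K`, then
  `(r + t) • μ + B t` belongs to `K` for all `t` as soon as `M ≤ c * r`. Hence, for `s > 0`,
  almost every path stays in `K` when started at `z + (k * s) • μ` with `k` large, and some
  `p (z + (k * s) • μ)` is positive (`exists_measure_coneTrap_pos`).
* For small `s`, with positive probability `B` moves less than the distance from `z` to the
  boundary of `K` during `[0, s]` and `B s ∈ K` (`exists_measure_norm_le_and_mem_cone_pos`). By the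
  Markov property at time `s` and the monotonicity of `p` along `K`, positivity of
  `p (z + (a + s) • μ)` implies that of `p (z + a • μ)` (`measure_coneTrap_pos_of_add`).

Descending from `k` to `0` gives `p z > 0`. Applied to a starting point slightly behind `z`, this
gives the statement for the interior of `K`.

Equality of laws and independence of paths are used only for the restrictions of paths to rational
times, which are random variables with values in a countable product.
-/

open Filter Topology

/-! ### Closed cones -/

section ProperCone

theorem ProperCone.add_mem_interior {E : Type*} [NormedAddCommGroup E] [NormedSpace ℝ E]
    (K : ProperCone ℝ E) {x y : E} (hx : x ∈ K) (hy : y ∈ interior (K : Set E)) :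
    x + y ∈ interior (K : Set E) := by
  refine interior_mono ?_
    (subset_interior_add_right (Set.add_mem_add (show x ∈ (K : Set E) from hx) hy))
  rintro _ ⟨a, ha, b, hb, rfl⟩
  exact K.add_mem ha hb

open scoped Pointwise in
theorem ProperCone.smul_mem_interior {E : Type*} [NormedAddCommGroup E] [NormedSpace ℝ E]
    (K : ProperCone ℝ E) {x : E} (hx : x ∈ interior (K : Set E)) {c : ℝ} (hc : 0 < c) :
    c • x ∈ interior (K : Set E) := by
  have h : c • x ∈ c • interior (K : Set E) := Set.smul_mem_smul_set hx
  rw [← interior_smul₀ hc.ne'] at h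
  refine interior_mono ?_ h
  rintro _ ⟨y, hy, rfl⟩
  exact K.smul_mem hy hc.le

theorem ProperCone.smul_add_mem_of_closedBall_subset {E : Type*} [NormedAddCommGroup E]
    [NormedSpace ℝ E] (K : ProperCone ℝ E) {μ u : E} {c r : ℝ}
    (hμ : Metric.closedBall μ c ⊆ (K : Set E)) (hr : 0 < r) (hu : ‖u‖ ≤ c * r) :
    r • μ + u ∈ K := by
  have h : μ + r⁻¹ • u ∈ K := by
    refine hμ ?_
    rw [Metric.mem_closedBall, dist_self_add_left, norm_smul, norm_inv, Real.norm_of_nonneg hr.le,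
      inv_mul_le_iff₀ hr, mul_comm]
    exact hu
  have h1 := K.smul_mem h hr.le
  rwa [smul_add, smul_inv_smul₀ hr.ne'] at h1

end ProperCone

/-! ### Real Brownian motion along rational times -/

theorem NNRat.denseRange_cast_nnreal : DenseRange ((↑) : ℚ≥0 → ℝ≥0) := by
  intro x
  rw [mem_closure_iff_nhds]
  intro U hU
  obtain ⟨u, hxu, hu⟩ := exists_Ico_subset_of_mem_nhds hU (exists_gt x)
  obtain ⟨q, hq0, hq1, hq2⟩ := (NNReal.lt_iff_exists_rat_btwn x u).1 hxu
  let r : ℚ≥0 := ⟨q, hq0⟩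
  have hq : (r : ℝ≥0) = Real.toNNReal q := by
    ext
    rw [Real.coe_toNNReal _ (by exact_mod_cast hq0)]
    rfl
  exact ⟨_, hu ⟨(hq ▸ hq1).le, hq ▸ hq2⟩, r, rfl⟩

section BrownianMotion

variable {Ω : Type*} [MeasurableSpace Ω] {P : Measure Ω}

theorem ProbabilityTheory.IsPreBrownianReal.map_nnrat_eq {X Y : ℝ≥0 → Ω → ℝ}
    (hX : IsPreBrownianReal X P) (hY : IsPreBrownianReal Y P) :
    P.map (fun ω (q : ℚ≥0) ↦ X q ω) = P.map (fun ω (q : ℚ≥0) ↦ Y q ω) := by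
  have := hX.isGaussianProcess.isProbabilityMeasure
  classical
  rw [map_eq_iff_forall_finset_map_restrict_eq (X := fun (q : ℚ≥0) ω ↦ X q ω)
    (Y := fun (q : ℚ≥0) ω ↦ Y q ω) (aemeasurable_pi_lambda _ fun q ↦ hX.aemeasurable q)
    (aemeasurable_pi_lambda _ fun q ↦ hY.aemeasurable q)]
  intro I
  let J : Finset ℝ≥0 := I.image (↑)
  let g : (J → ℝ) → (I → ℝ) := fun x i ↦ x ⟨i, Finset.mem_image_of_mem _ i.2⟩
  have hg : Measurable g := by fun_prop
  have h1 := congrArg (Measure.map g) ((hX.hasLaw J).map_eq.trans (hY.hasLaw J).map_eq.symm)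
  rwa [AEMeasurable.map_map_of_aemeasurable hg.aemeasurable (hX.hasLaw J).aemeasurable,
    AEMeasurable.map_map_of_aemeasurable hg.aemeasurable (hY.hasLaw J).aemeasurable] at h1

/-- A Brownian path grows sublinearly, almost surely. -/
theorem ProbabilityTheory.IsBrownianReal.ae_exists_abs_le_add_mul {B : ℝ≥0 → Ω → ℝ}
    (hB : IsBrownianReal B P) :
    ∀ᵐ ω ∂P, ∀ c : ℝ, 0 < c → ∃ M : ℝ, ∀ t : ℝ≥0, |B t ω| ≤ M + c * t := by
  -- The paths that tend to `0` at time `0` along the rationals.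
  let S : Set (ℚ≥0 → ℝ) :=
    {x | ∀ n : ℕ, ∃ m : ℕ, ∀ q : ℚ≥0, q ≤ 1 / (m + 1) → |x q| ≤ 1 / (n + 1)}
  have hS : MeasurableSet S := by
    simp only [S, Set.ofPred_forall, Set.ofPred_exists]
    refine .iInter fun n ↦ .iUnion fun m ↦ .iInter fun q ↦ .iInter fun _ ↦ ?_
    exact measurableSet_le (by fun_prop) (by fun_prop)
  have hBS : ∀ᵐ ω ∂P, (fun q : ℚ≥0 ↦ B q ω) ∈ S := by
    filter_upwards [hB.tendsto_nhds_zero] with ω hω n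
    obtain ⟨δ, hδ, h⟩ := Metric.tendsto_nhds_nhds.1 hω (1 / (n + 1)) Nat.one_div_pos_of_nat
    obtain ⟨m, hm⟩ := exists_nat_one_div_lt hδ
    refine ⟨m, fun q hq ↦ ?_⟩
    have hq' : (q : ℝ) ≤ 1 / (m + 1) := by
      have h := (NNRat.cast_le (K := ℝ)).2 hq
      push_cast at h
      exact h
    have h1 := h (x := (q : ℝ≥0)) (by
      rw [NNReal.dist_eq, NNReal.coe_zero, sub_zero, NNReal.abs_eq]
      exact_mod_cast hq'.trans_lt hm)
    simpa using h1.le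
  -- Time inversion yields a process with the same law, which therefore also tends to `0`.
  have hXS : ∀ᵐ ω ∂P, (fun q : ℚ≥0 ↦ (q : ℝ≥0) * B (1 / (q : ℝ≥0)) ω) ∈ S := by
    have hX := hB.toIsPreBrownianReal.inv
    have h := hX.map_nnrat_eq hB.toIsPreBrownianReal
    have h1 := (ae_map_iff (aemeasurable_pi_lambda _ fun q : ℚ≥0 ↦ hB.aemeasurable q) hS).2 hBS
    rw [← h] at h1
    exact ae_of_ae_map (aemeasurable_pi_lambda _ fun q : ℚ≥0 ↦ hX.aemeasurable q) h1
  -- Hence `|B q| ≤ c * q` for rational `q ≥ m + 1`, while `B` is bounded on `[0, m + 1]`.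
  filter_upwards [hXS, hB.cont] with ω hω hc c hc0
  obtain ⟨n, hn⟩ := exists_nat_one_div_lt hc0
  obtain ⟨m, hm⟩ := hω n
  obtain ⟨M, hM⟩ := (isCompact_Icc (a := (0 : ℝ≥0)) (b := m + 1)).exists_bound_of_continuousOn
    hc.continuousOn
  refine ⟨|M|, fun t ↦ ?_⟩
  have hcl : IsClosed {t : ℝ≥0 | |B t ω| ≤ |M| + c * t} := isClosed_le (by fun_prop) (by fun_prop)
  refine NNRat.denseRange_cast_nnreal.induction_on t hcl fun q ↦ ?_
  rcases le_total (q : ℝ≥0) (m + 1) with hq | hq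
  · have := hM q ⟨zero_le, hq⟩
    rw [Real.norm_eq_abs] at this
    have : 0 ≤ c * ((q : ℝ≥0) : ℝ) := by positivity
    linarith [le_abs_self M]
  · have hq0 : 0 < q := by
      rw [← NNRat.cast_pos (K := ℝ≥0)]
      exact lt_of_lt_of_le (by positivity) hq
    have hqm : (m : ℚ≥0) + 1 ≤ q := by exact_mod_cast hq
    have h1 := hm q⁻¹ (by rw [inv_eq_one_div]; exact one_div_le_one_div_of_le (by positivity) hqm)
    have hqr : (0 : ℝ) < ((q : ℝ≥0) : ℝ) := by exact_mod_cast hq0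
    have h2 : |B q ω| ≤ 1 / (n + 1) * ((q : ℝ≥0) : ℝ) := by
      simp only [NNRat.cast_inv, one_div, inv_inv, NNReal.coe_inv, abs_mul, abs_inv,
        NNReal.abs_eq] at h1
      rw [inv_mul_le_iff₀ hqr] at h1
      simpa [mul_comm] using h1
    have h3 : 1 / ((n : ℝ) + 1) * ((q : ℝ≥0) : ℝ) ≤ c * ((q : ℝ≥0) : ℝ) := by gcongr
    linarith [abs_nonneg M]

/-! ### Independence of families of pairs -/

/-- If the pairs `(F i, G i)` are independent of each other, and `F i` is independent of `G i` for
each `i`, then the whole family `F` is independent of the whole family `G`. -/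
theorem indepFun_pi_of_iIndepFun_prodMk {ι α β : Type*} [Fintype ι] [MeasurableSpace α]
    [MeasurableSpace β] [IsProbabilityMeasure P] {F : ι → Ω → α} {G : ι → Ω → β}
    (hF : ∀ i, AEMeasurable (F i) P) (hG : ∀ i, AEMeasurable (G i) P)
    (h : iIndepFun (fun i ω ↦ (F i ω, G i ω)) P) (hFG : ∀ i, IndepFun (F i) (G i) P) :
    IndepFun (fun ω i ↦ F i ω) (fun ω i ↦ G i ω) P := by
  have hF1 : iIndepFun F P := h.comp (fun _ ↦ Prod.fst) fun _ ↦ measurable_fst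
  have hG1 : iIndepFun G P := h.comp (fun _ ↦ Prod.snd) fun _ ↦ measurable_snd
  have : ∀ i, IsProbabilityMeasure (P.map (F i)) := fun i ↦ Measure.isProbabilityMeasure_map (hF i)
  have : ∀ i, IsProbabilityMeasure (P.map (G i)) := fun i ↦ Measure.isProbabilityMeasure_map (hG i)
  rw [indepFun_iff_map_prod_eq_prod_map_map (aemeasurable_pi_lambda _ hF)
    (aemeasurable_pi_lambda _ hG), (iIndepFun_iff_map_fun_eq_pi_map hF).1 hF1,
    (iIndepFun_iff_map_fun_eq_pi_map hG).1 hG1]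
  have h1 := (iIndepFun_iff_map_fun_eq_pi_map fun i ↦ (hF i).prodMk (hG i)).1 h
  simp_rw [fun i ↦ (indepFun_iff_map_prod_eq_prod_map_map (hF i) (hG i)).1 (hFG i)] at h1
  have h2 := measurePreserving_arrowProdEquivProdArrow α β ι (fun i ↦ P.map (F i))
    (fun i ↦ P.map (G i))
  rw [← h2.map_eq, ← h1, AEMeasurable.map_map_of_aemeasurable (by fun_prop)
    (aemeasurable_pi_lambda _ fun i ↦ (hF i).prodMk (hG i))]
  rfl

/-! ### Events that a continuous process stays in an open set -/

theorem nullMeasurableSet_forall_mem_of_isOpen {E : Type*} [PseudoMetricSpace E] [MeasurableSpace E]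
    [OpensMeasurableSpace E] {X : ℝ≥0 → Ω → E} (hX : ∀ t, AEMeasurable (X t) P)
    (hc : ∀ᵐ ω ∂P, Continuous (X · ω)) {U : Set E} (hU : IsOpen U) :
    NullMeasurableSet {ω | ∀ t, X t ω ∈ U} P := by
  rcases Set.eq_empty_or_nonempty Uᶜ with hUe | hne
  · have : U = Set.univ := Set.compl_empty_iff.1 hUe
    simp [this]
  -- By compactness, the path stays in `U` iff on each `[0, N]` its distance to the complement of
  -- `U` is bounded below by some `1 / (m + 1)`, and rational times suffice to test this.
  let f : ℝ≥0 → Ω → ℝ := fun t ω ↦ Metric.infDist (X t ω) Uᶜ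
  have hf t : AEMeasurable (f t) P :=
    (Metric.continuous_infDist_pt _).measurable.comp_aemeasurable (hX t)
  have hS : NullMeasurableSet
      {ω | ∀ N : ℕ, ∃ m : ℕ, ∀ q : ℚ≥0, q ≤ N → 1 / (m + 1 : ℝ) ≤ f q ω} P := by
    simp only [Set.ofPred_forall, Set.ofPred_exists]
    refine .iInter fun N ↦ .iUnion fun m ↦ .iInter fun q ↦ .iInter fun _ ↦ ?_
    exact nullMeasurableSet_le aemeasurable_const (hf q)
  refine hS.congr ?_
  filter_upwards [hc] with ω hω
  have hfc : Continuous (f · ω) := (Metric.continuous_infDist_pt _).comp hω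
  have hmem t : X t ω ∈ U ↔ 0 < f t ω := by
    rw [← hU.isClosed_compl.notMem_iff_infDist_pos hne, Set.notMem_compl_iff]
  refine propext ⟨fun h t ↦ ?_, fun h N ↦ ?_⟩
  · obtain ⟨N, hN⟩ := exists_nat_gt t
    obtain ⟨m, hm⟩ := h N
    rw [hmem]
    refine lt_of_lt_of_le (Nat.one_div_pos_of_nat (n := m)) ?_
    by_contra! hlt
    have hopen : IsOpen {s : ℝ≥0 | s < N ∧ f s ω < 1 / (m + 1 : ℝ)} :=
      (isOpen_lt (by fun_prop) (by fun_prop)).inter (isOpen_lt hfc (by fun_prop))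
    obtain ⟨q, hq1, hq2⟩ := NNRat.denseRange_cast_nnreal.exists_mem_open hopen ⟨t, hN, hlt⟩
    exact absurd (hm q (by exact_mod_cast hq1.le)) hq2.not_ge
  · obtain ⟨t₀, -, ht₀⟩ := (isCompact_Icc (a := (0 : ℝ≥0)) (b := N)).exists_isMinOn
      ⟨0, by simp⟩ hfc.continuousOn
    obtain ⟨m, hm⟩ := exists_nat_one_div_lt ((hmem t₀).1 (h t₀))
    exact ⟨m, fun q hq ↦ hm.le.trans (ht₀ ⟨zero_le, by exact_mod_cast hq⟩)⟩

namespace IsStandardBrownianMotion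

variable {d : ℕ} {B B' : ℝ≥0 → Ω → EuclideanSpace ℝ (Fin d)}

/-! ### Law and Markov property of multidimensional Brownian motion -/

theorem aemeasurable (hB : IsStandardBrownianMotion B P) (t : ℝ≥0) : AEMeasurable (B t) P :=
  (WithLp.measurable_toLp 2 (Fin d → ℝ)).comp_aemeasurable
    (aemeasurable_pi_lambda _ fun i ↦ (hB.isBrownianReal_coord i).aemeasurable t)

theorem ae_continuous (hB : IsStandardBrownianMotion B P) : ∀ᵐ ω ∂P, Continuous (B · ω) := by
  filter_upwards [ae_all_iff.2 fun i ↦ (hB.isBrownianReal_coord i).cont] with ω hω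
  exact (PiLp.continuous_toLp 2 _).comp (continuous_pi hω)

theorem ae_eval_zero (hB : IsStandardBrownianMotion B P) : ∀ᵐ ω ∂P, B 0 ω = 0 := by
  filter_upwards [ae_all_iff.2 fun i ↦ (hB.isBrownianReal_coord i).eval_zero_ae_eq_zero] with ω hω
  ext i
  exact hω i

theorem shift (hB : IsStandardBrownianMotion B P) (s : ℝ≥0) :
    IsStandardBrownianMotion (fun t ω ↦ B (s + t) ω - B s ω) P where
  isBrownianReal_coord i := (hB.isBrownianReal_coord i).shift s
  iIndepFun_coord := hB.iIndepFun_coord.comp (fun _ x t ↦ x (s + t) - x s) fun _ ↦ by fun_prop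

theorem map_nnrat_eq (hB : IsStandardBrownianMotion B P) (hB' : IsStandardBrownianMotion B' P)
    [IsProbabilityMeasure P] :
    P.map (fun ω (q : ℚ≥0) ↦ B q ω) = P.map (fun ω (q : ℚ≥0) ↦ B' q ω) := by
  let Φ : (Fin d → ℚ≥0 → ℝ) → ℚ≥0 → EuclideanSpace ℝ (Fin d) :=
    fun x q ↦ WithLp.toLp 2 fun i ↦ x i q
  have hΦ : Measurable Φ := by fun_prop
  have key (C : ℝ≥0 → Ω → EuclideanSpace ℝ (Fin d)) (hC : IsStandardBrownianMotion C P) :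
      P.map (fun ω (q : ℚ≥0) ↦ C q ω) =
        (Measure.pi fun i ↦ P.map (fun ω (q : ℚ≥0) ↦ C q ω i)).map Φ := by
    have hm i : AEMeasurable (fun ω (q : ℚ≥0) ↦ C q ω i) P :=
      aemeasurable_pi_lambda _ fun q ↦ (hC.isBrownianReal_coord i).aemeasurable q
    have hi : iIndepFun (fun i ω (q : ℚ≥0) ↦ C q ω i) P :=
      hC.iIndepFun_coord.comp (fun _ x (q : ℚ≥0) ↦ x q) fun _ ↦ by fun_prop
    rw [← hi.map_fun_eq_pi_map hm,
      AEMeasurable.map_map_of_aemeasurable hΦ.aemeasurable (aemeasurable_pi_lambda _ hm)]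
    rfl
  rw [key B hB, key B' hB']
  congr! 3 with i
  exact (hB.isBrownianReal_coord i).toIsPreBrownianReal.map_nnrat_eq
    (hB'.isBrownianReal_coord i).toIsPreBrownianReal

/-- The **Markov property** at a deterministic time `s`, along rational times: the increments after
`s` are independent of the path stopped at `s`. -/
theorem indepFun_shift [IsProbabilityMeasure P] (hB : IsStandardBrownianMotion B P) (s : ℝ≥0) :
    IndepFun (fun ω (q : ℚ≥0) ↦ B (s + q) ω - B s ω) (fun ω (q : ℚ≥0) ↦ B (min q s) ω) P := by
  let Φ : (Fin d → ℚ≥0 → ℝ) → ℚ≥0 → EuclideanSpace ℝ (Fin d) :=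
    fun x q ↦ WithLp.toLp 2 fun i ↦ x i q
  have hΦ : Measurable Φ := by fun_prop
  have h := indepFun_pi_of_iIndepFun_prodMk (P := P)
    (F := fun i ω (q : ℚ≥0) ↦ B (s + q) ω i - B s ω i) (G := fun i ω (q : ℚ≥0) ↦ B (min q s) ω i)
    (fun i ↦ aemeasurable_pi_lambda _ fun q ↦ ((hB.isBrownianReal_coord i).aemeasurable _).sub
      ((hB.isBrownianReal_coord i).aemeasurable _))
    (fun i ↦ aemeasurable_pi_lambda _ fun q ↦ (hB.isBrownianReal_coord i).aemeasurable _)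
    (hB.iIndepFun_coord.comp
      (fun _ x ↦ ((fun (q : ℚ≥0) ↦ x (s + q) - x s), fun (q : ℚ≥0) ↦ x (min q s)))
      fun _ ↦ by fun_prop)
    fun i ↦ ((hB.isBrownianReal_coord i).indepFun_shift s).comp
      (φ := fun (x : ℝ≥0 → ℝ) (q : ℚ≥0) ↦ x q)
      (ψ := fun (x : Set.Iic s → ℝ) (q : ℚ≥0) ↦ x ⟨min q s, Set.mem_Iic.2 (min_le_right _ _)⟩)
      (by fun_prop) (by fun_prop)
  exact h.comp hΦ hΦ

theorem hasLaw_inv_sqrt_mul [IsProbabilityMeasure P] (hB : IsStandardBrownianMotion B P)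
    {s : ℝ≥0} (hs : s ≠ 0) :
    HasLaw (fun ω i ↦ (√s)⁻¹ * B s ω i) (Measure.pi fun _ : Fin d ↦ gaussianReal 0 1) P := by
  refine iIndepFun.hasLaw_pi (fun i ↦ ?_) ?_
  · simpa using ((hB.isBrownianReal_coord i).smul hs).hasLaw_eval 1
  · exact hB.iIndepFun_coord.comp (fun _ x ↦ (√s)⁻¹ * x s) fun _ ↦ by fun_prop

/-! ### Large-time and small-time estimates -/

theorem ae_exists_norm_le_add_mul (hB : IsStandardBrownianMotion B P) {c : ℝ} (hc : 0 < c) :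
    ∀ᵐ ω ∂P, ∃ M : ℝ, ∀ t : ℝ≥0, ‖B t ω‖ ≤ M + c * t := by
  filter_upwards [ae_all_iff.2 fun i ↦ (hB.isBrownianReal_coord i).ae_exists_abs_le_add_mul]
    with ω hω
  -- Each coordinate gets the slope `c / (d + 1)`; the `+ 1` covers the case `d = 0`.
  have hd : (0 : ℝ) < d + 1 := by positivity
  choose M hM using fun i ↦ hω i (c / (d + 1)) (by positivity)
  refine ⟨∑ i, M i, fun t ↦ ?_⟩
  calc ‖B t ω‖ ≤ ∑ i, ‖B t ω i‖ := by
        nth_rewrite 1 [← (EuclideanSpace.basisFun (Fin d) ℝ).sum_repr (B t ω)]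
        refine (norm_sum_le _ _).trans (Finset.sum_le_sum fun i _ ↦ ?_)
        simp [norm_smul]
    _ ≤ ∑ i, (M i + c / (d + 1) * t) := Finset.sum_le_sum fun i _ ↦ hM i t
    _ = ∑ i, M i + d / (d + 1) * (c * t) := by
        rw [Finset.sum_add_distrib]
        simp
        ring
    _ ≤ ∑ i, M i + c * t := by
        have h1 : (d : ℝ) / (d + 1) ≤ 1 := (div_le_one hd).2 (by linarith)
        have h2 : 0 ≤ c * (t : ℝ) := by positivity
        linarith [mul_le_of_le_one_left h2 h1]

theorem exists_measure_norm_gt_lt [IsProbabilityMeasure P]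
    (hB : IsStandardBrownianMotion B P) {ε : ℝ} (hε : 0 < ε)
    {δ : ENNReal} (hδ : 0 < δ) :
    ∃ s : ℚ≥0, 0 < s ∧ P {ω | ∀ q : ℚ≥0, q ≤ s → ‖B q ω‖ ≤ ε}ᶜ < δ := by
  let S : ℕ → Set Ω := fun n ↦ {ω | ∀ q : ℚ≥0, q ≤ 1 / (n + 1) → ‖B q ω‖ ≤ ε}ᶜ
  have hS n : NullMeasurableSet (S n) P := by
    simp only [S, Set.ofPred_forall]
    exact (NullMeasurableSet.iInter fun q : ℚ≥0 ↦ .iInter fun _ ↦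
      nullMeasurableSet_le (hB.aemeasurable q).norm aemeasurable_const).compl
  have hanti : Antitone S := fun n m hnm ↦ Set.compl_subset_compl.2 fun ω hω q hq ↦
    hω q (hq.trans (Nat.one_div_le_one_div hnm))
  have hnull : P (⋂ n, S n) = 0 := by
    rw [measure_eq_zero_iff_ae_notMem]
    filter_upwards [hB.ae_continuous, hB.ae_eval_zero] with ω hc h0 hmem
    obtain ⟨η, hη, h⟩ := Metric.continuous_iff.1 hc 0 ε hε
    obtain ⟨n, hn⟩ := exists_nat_one_div_lt hη
    refine Set.mem_iInter.1 hmem n fun q hq ↦ ?_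
    have hq' : (q : ℝ) ≤ 1 / (n + 1) := by
      have h := (NNRat.cast_le (K := ℝ)).2 hq
      push_cast at h
      exact h
    have h1 := h (q : ℝ≥0) (by
      rw [NNReal.dist_eq, NNReal.coe_zero, sub_zero, NNReal.abs_eq]
      exact_mod_cast hq'.trans_lt hn)
    rw [h0, dist_zero_right] at h1
    exact h1.le
  have hlim := tendsto_measure_iInter_atTop hS hanti ⟨0, measure_ne_top _ _⟩
  rw [hnull] at hlim
  obtain ⟨n, hn⟩ := (hlim.eventually_lt_const hδ).exists
  exact ⟨1 / (n + 1), by positivity, hn⟩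

/-- The probability that `B s` lies in a cone with nonempty interior is bounded below
uniformly in the time `s`, by Brownian scaling. -/
theorem exists_pos_le_measure_mem_cone [IsProbabilityMeasure P] (hB : IsStandardBrownianMotion B P)
    (K : ProperCone ℝ (EuclideanSpace ℝ (Fin d)))
    (hK : (interior (K : Set (EuclideanSpace ℝ (Fin d)))).Nonempty) :
    ∃ δ > 0, ∀ s : ℝ≥0, s ≠ 0 → δ ≤ P {ω | B s ω ∈ K} := by
  -- `δ` is the mass that the standard Gaussian law gives to the interior of `K`.
  let U : Set (Fin d → ℝ) := WithLp.toLp 2 ⁻¹' interior (K : Set (EuclideanSpace ℝ (Fin d)))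
  have hU : IsOpen U := isOpen_interior.preimage (PiLp.continuous_toLp 2 _)
  have hpos : (gaussianReal 0 1).IsOpenPosMeasure :=
    (gaussianReal_absolutelyContinuous' 0 one_ne_zero).isOpenPosMeasure
  refine ⟨(Measure.pi fun _ : Fin d ↦ gaussianReal 0 1) U, ?_, fun s hs ↦ ?_⟩
  · obtain ⟨y, hy⟩ := hK
    exact hU.measure_pos _ ⟨y.ofLp, hy⟩
  · refine ((hB.hasLaw_inv_sqrt_mul hs).measure_eq (p := (· ∈ U)) hU.measurableSet).ge.trans ?_
    refine measure_mono fun ω hω ↦ ?_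
    have hs' : 0 < √(s : ℝ) := Real.sqrt_pos.2 (by positivity)
    have h1 := K.smul_mem (interior_subset hω) hs'.le
    have h2 : √(s : ℝ) • WithLp.toLp 2 (fun i ↦ (√(s : ℝ))⁻¹ * B s ω i) = B s ω := by
      ext i
      simp [hs'.ne']
    rwa [h2] at h1

/-- With positive probability a Brownian motion spends a short time interval in a small ball and
sits in a given cone at the end of it. Both events are compatible because, by scaling, the
probability of the second one does not depend on the length of the interval, whereas that of the
first one tends to `1` as this length tends to `0`. -/
theorem exists_measure_norm_le_and_mem_cone_pos [IsProbabilityMeasure P]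
    (hB : IsStandardBrownianMotion B P) (K : ProperCone ℝ (EuclideanSpace ℝ (Fin d)))
    (hK : (interior (K : Set (EuclideanSpace ℝ (Fin d)))).Nonempty) {ε : ℝ} (hε : 0 < ε) :
    ∃ s : ℚ≥0, 0 < s ∧ 0 < P {ω | (∀ q : ℚ≥0, q ≤ s → ‖B q ω‖ ≤ ε) ∧ B s ω ∈ K} := by
  obtain ⟨δ, hδ, hcone⟩ := hB.exists_pos_le_measure_mem_cone K hK
  obtain ⟨s, hs, hsmall⟩ := hB.exists_measure_norm_gt_lt hε hδ
  refine ⟨s, hs, ?_⟩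
  by_contra! h0
  have hsub : {ω | B s ω ∈ K} ⊆ {ω | (∀ q : ℚ≥0, q ≤ s → ‖B q ω‖ ≤ ε) ∧ B s ω ∈ K} ∪
      {ω | ∀ q : ℚ≥0, q ≤ s → ‖B q ω‖ ≤ ε}ᶜ := by
    intro ω hω
    by_cases h : ∀ q : ℚ≥0, q ≤ s → ‖B q ω‖ ≤ ε
    · exact .inl ⟨h, hω⟩
    · exact .inr h
  have h2 := (measure_mono (μ := P) hsub).trans (measure_union_le _ _)
  rw [nonpos_iff_eq_zero.1 h0, zero_add] at h2
  exact ((hcone s (by simpa using hs.ne')).trans h2).not_gt hsmall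

/-! ### Staying in a cone -/

/-- The set of paths `x`, indexed by the nonnegative rationals, along which the drifted motion
`w + x q + q • μ` started at `w` stays in the cone `K`. Restricting to rational times makes this set
measurable; as `K` is closed, nothing is lost for continuous paths. -/
def coneTrap (K : ProperCone ℝ (EuclideanSpace ℝ (Fin d))) (μ w : EuclideanSpace ℝ (Fin d)) :
    Set (ℚ≥0 → EuclideanSpace ℝ (Fin d)) :=
  {x | ∀ q : ℚ≥0, w + x q + (q : ℝ) • μ ∈ K}

theorem measurableSet_coneTrap (K : ProperCone ℝ (EuclideanSpace ℝ (Fin d)))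
    (μ w : EuclideanSpace ℝ (Fin d)) : MeasurableSet (coneTrap K μ w) := by
  simp only [coneTrap, Set.ofPred_forall]
  refine .iInter fun q ↦ ?_
  exact K.isClosed.measurableSet.preimage
    (f := fun x : ℚ≥0 → EuclideanSpace ℝ (Fin d) ↦ w + x q + (q : ℝ) • μ) (by fun_prop)

/-- Started far enough in the direction of the drift, the motion stays in the cone with positive
probability. -/
theorem exists_measure_coneTrap_pos [IsProbabilityMeasure P]
    (hB : IsStandardBrownianMotion B P)
    (K : ProperCone ℝ (EuclideanSpace ℝ (Fin d))) {μ z : EuclideanSpace ℝ (Fin d)}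
    (hμ : μ ∈ interior (K : Set (EuclideanSpace ℝ (Fin d)))) (hz : z ∈ K) {s : ℝ} (hs : 0 < s) :
    ∃ k : ℕ, 0 < P {ω | (fun q : ℚ≥0 ↦ B q ω) ∈ coneTrap K μ (z + (k * s) • μ)} := by
  by_contra! h
  have hnull := measure_iUnion_null fun k ↦ nonpos_iff_eq_zero.1 (h k)
  obtain ⟨c, hc, hball⟩ := Metric.nhds_basis_closedBall.mem_iff.1 (mem_interior_iff_mem_nhds.1 hμ)
  have hne : (ae P).NeBot := inferInstance
  obtain ⟨ω, hω, M, hM⟩ := ((measure_eq_zero_iff_ae_notMem.1 hnull).and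
    (hB.ae_exists_norm_le_add_mul hc)).exists
  refine hω (Set.mem_iUnion.2 ?_)
  -- `k * s` is so large that `c * (k * s)` exceeds the additive constant `M`.
  obtain ⟨k, hk⟩ := exists_nat_gt (max 0 (M / c) / s)
  rw [div_lt_iff₀ hs, max_lt_iff] at hk
  refine ⟨k, fun q ↦ ?_⟩
  have h1 : (k * s + q) • μ + B q ω ∈ K := by
    refine K.smul_add_mem_of_closedBall_subset hball
      (add_pos_of_pos_of_nonneg hk.1 q.cast_nonneg) ?_
    have h2 := hM q
    have h3 := (div_lt_iff₀ hc).1 hk.2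
    have h4 : ((q : ℝ≥0) : ℝ) = q := rfl
    rw [h4] at h2
    linarith
  have h2 : z + (k * s) • μ + B q ω + (q : ℝ) • μ = z + ((k * s + q) • μ + B q ω) := by module
  exact h2 ▸ K.add_mem hz h1

/-- If the drifted motion started at `z + (a + s) • μ` stays in the cone with positive probability,
so does the one started at `z + a • μ`: on the event that the motion is small on `[0, s]` and in
the cone at time `s`, its position at time `s` lies in the cone with apex `z + (a + s) • μ`, and
by the Markov property it starts afresh from there. -/
theorem measure_coneTrap_pos_of_add [IsProbabilityMeasure P] (hB : IsStandardBrownianMotion B P)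
    (K : ProperCone ℝ (EuclideanSpace ℝ (Fin d))) {μ z : EuclideanSpace ℝ (Fin d)} (hμ : μ ∈ K)
    {ε : ℝ} (hball : Metric.closedBall z ε ⊆ (K : Set (EuclideanSpace ℝ (Fin d)))) {s : ℚ≥0}
    (hs : 0 < P {ω | (∀ q : ℚ≥0, q ≤ s → ‖B q ω‖ ≤ ε) ∧ B s ω ∈ K}) {a : ℝ} (ha : 0 ≤ a)
    (h : 0 < P {ω | (fun q : ℚ≥0 ↦ B q ω) ∈ coneTrap K μ (z + (a + s) • μ)}) :
    0 < P {ω | (fun q : ℚ≥0 ↦ B q ω) ∈ coneTrap K μ (z + a • μ)} := by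
  have hC := measurableSet_coneTrap K μ (z + (a + s) • μ)
  have hm {X : ℝ≥0 → Ω → EuclideanSpace ℝ (Fin d)} (hX : IsStandardBrownianMotion X P) :
      AEMeasurable (fun ω (q : ℚ≥0) ↦ X q ω) P := aemeasurable_pi_lambda _ fun q ↦
    hX.aemeasurable q
  have hF : 0 < P ((fun ω (q : ℚ≥0) ↦ B (s + q) ω - B s ω) ⁻¹'
      coneTrap K μ (z + (a + s) • μ)) := by
    rw [← Measure.map_apply_of_aemeasurable (hm (hB.shift s)) hC,
      (hB.shift s).map_nnrat_eq hB, Measure.map_apply_of_aemeasurable (hm hB) hC]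
    exact h
  -- The hypothesis `hs` as a statement on the path stopped at time `s`.
  let E : Set (ℚ≥0 → EuclideanSpace ℝ (Fin d)) :=
    {x | ∀ q, q ≤ s → ‖x q‖ ≤ ε} ∩ {x | x s ∈ K}
  have hE : MeasurableSet E := by
    refine .inter ?_ (K.isClosed.measurableSet.preimage (measurable_pi_apply s))
    simp only [Set.ofPred_forall]
    exact .iInter fun q ↦ .iInter fun _ ↦ measurableSet_le (by fun_prop) (by fun_prop)
  have h_min {q : ℚ≥0} (hq : q ≤ s) (ω : Ω) : B (min q s) ω = B q ω := by
    rw [min_eq_left (show (q : ℝ≥0) ≤ s by exact_mod_cast hq)]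
  have hEpos : 0 < P ((fun ω (q : ℚ≥0) ↦ B (min q s) ω) ⁻¹' E) := by
    refine hs.trans_le (measure_mono ?_)
    rintro ω ⟨hω, hωs⟩
    refine ⟨fun q hq ↦ ?_, ?_⟩
    · exact (congrArg norm (h_min hq ω)).trans_le (hω q hq)
    · change B (min s s) ω ∈ K
      rwa [h_min le_rfl ω]
  have hind := (hB.indepFun_shift s).measure_inter_preimage_eq_mul _ _ hC hE
  refine (lt_of_lt_of_eq (ENNReal.mul_pos hF.ne' hEpos.ne') hind.symm).trans_le (measure_mono ?_)
  rintro ω ⟨hωC, hωE, hωs⟩ q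
  have hωs' : B s ω ∈ K := h_min le_rfl ω ▸ hωs
  rcases le_total q s with hq | hq
  · have h1 : z + B q ω ∈ K := by
      refine hball ?_
      rw [Metric.mem_closedBall, dist_self_add_left]
      exact h_min hq ω ▸ hωE q hq
    have h2 : (a + q) • μ ∈ K := K.smul_mem hμ (by positivity)
    have h3 : z + a • μ + B q ω + (q : ℝ) • μ = z + B q ω + (a + q) • μ := by module
    exact h3 ▸ K.add_mem h1 h2
  · obtain ⟨r, rfl⟩ := exists_add_of_le hq
    have h3 : z + a • μ + B (s + r : ℚ≥0) ω + ((s + r : ℚ≥0) : ℝ) • μ =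
        z + (a + s) • μ + (B (s + r) ω - B s ω) + (r : ℝ) • μ + B s ω := by
      push_cast
      module
    exact h3 ▸ K.add_mem (hωC r) hωs'

theorem measure_coneTrap_pos [IsProbabilityMeasure P] (hB : IsStandardBrownianMotion B P)
    (K : ProperCone ℝ (EuclideanSpace ℝ (Fin d))) {μ z : EuclideanSpace ℝ (Fin d)}
    (hμ : μ ∈ interior (K : Set (EuclideanSpace ℝ (Fin d))))
    (hz : z ∈ interior (K : Set (EuclideanSpace ℝ (Fin d)))) :
    0 < P {ω | (fun q : ℚ≥0 ↦ B q ω) ∈ coneTrap K μ z} := by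
  obtain ⟨ε, hε, hball⟩ := Metric.nhds_basis_closedBall.mem_iff.1 (mem_interior_iff_mem_nhds.1 hz)
  obtain ⟨s, hs, hpos⟩ := hB.exists_measure_norm_le_and_mem_cone_pos K ⟨μ, hμ⟩ hε
  obtain ⟨k, hk⟩ := hB.exists_measure_coneTrap_pos K hμ (interior_subset hz)
    (s := s) (by exact_mod_cast hs)
  induction k with
  | zero => simpa using hk
  | succ k ih =>
    refine ih (hB.measure_coneTrap_pos_of_add K (interior_subset hμ) hball hpos (by positivity) ?_)
    rwa [← add_one_mul, ← Nat.cast_succ]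

theorem measure_forall_mem_interior_pos [IsProbabilityMeasure P]
    (hB : IsStandardBrownianMotion B P)
    (K : ProperCone ℝ (EuclideanSpace ℝ (Fin d))) {μ z : EuclideanSpace ℝ (Fin d)}
    (hμ : μ ∈ interior (K : Set (EuclideanSpace ℝ (Fin d))))
    (hz : z ∈ interior (K : Set (EuclideanSpace ℝ (Fin d)))) :
    0 < P {ω | ∀ t : ℝ≥0, z + B t ω + (t : ℝ) • μ ∈
      interior (K : Set (EuclideanSpace ℝ (Fin d)))} := by
  -- Start from `z - δ • μ`, still interior to `K`: staying in `K` from there is staying in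
  -- `δ • μ + K`, which is contained in the interior of `K`, from `z`.
  have hcont : Continuous fun δ : ℝ ↦ z - δ • μ := by fun_prop
  have hev : ∀ᶠ δ in 𝓝[>] (0 : ℝ), z - δ • μ ∈ interior (K : Set (EuclideanSpace ℝ (Fin d))) :=
    (hcont.tendsto 0).mono_left nhdsWithin_le_nhds |>.eventually
      (by simpa using isOpen_interior.mem_nhds hz)
  obtain ⟨δ, hδz, hδ⟩ := (hev.and self_mem_nhdsWithin).exists
  refine (hB.measure_coneTrap_pos K hμ hδz).trans_le (measure_mono_ae ?_)
  filter_upwards [hB.ae_continuous] with ω hc hω t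
  have hcl : IsClosed {t : ℝ≥0 | z - δ • μ + B t ω + (t : ℝ) • μ ∈ K} :=
    K.isClosed.preimage (by fun_prop)
  have h1 : z - δ • μ + B t ω + (t : ℝ) • μ ∈ K :=
    NNRat.denseRange_cast_nnreal.induction_on t hcl hω
  have h2 : δ • μ ∈ interior (K : Set (EuclideanSpace ℝ (Fin d))) := K.smul_mem_interior hμ hδ
  have h3 : z + B t ω + (t : ℝ) • μ = z - δ • μ + B t ω + (t : ℝ) • μ + δ • μ := by module
  exact h3 ▸ K.add_mem_interior h1 h2

end IsStandardBrownianMotion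

end BrownianMotion

/-! ### The wedge -/

/-- The wedge of angle `ξ ∈ (0, π)` is the intersection of the closed upper half-plane and the
closed half-plane to the right of the line directed by `(cos ξ, sin ξ)`. -/
theorem mem_wedge_iff {ξ : ℝ} (hξ0 : 0 < ξ) (hξπ : ξ < Real.pi) (x : EuclideanSpace ℝ (Fin 2)) :
    x ∈ wedge ξ ↔ 0 ≤ x 1 ∧ 0 ≤ x 0 * Real.sin ξ - x 1 * Real.cos ξ := by
  constructor
  · rintro ⟨r, θ, hr, hθ0, hθξ, rfl⟩
    have h1 := Real.sin_nonneg_of_nonneg_of_le_pi hθ0 (hθξ.trans hξπ.le)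
    have h2 := Real.sin_nonneg_of_nonneg_of_le_pi (sub_nonneg.2 hθξ) (by linarith)
    rw [Real.sin_sub] at h2
    refine ⟨by simpa using mul_nonneg hr h1, ?_⟩
    have h3 := mul_nonneg hr h2
    simp
    linarith
  · rintro ⟨h1, h2⟩
    let w : ℂ := ⟨x 0, x 1⟩
    have hre : ‖w‖ * Real.cos w.arg = x 0 := Complex.norm_mul_cos_arg w
    have him : ‖w‖ * Real.sin w.arg = x 1 := Complex.norm_mul_sin_arg w
    have hx : x = !₂[‖w‖ * Real.cos w.arg, ‖w‖ * Real.sin w.arg] := by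
      ext i
      fin_cases i
      · exact hre.symm
      · exact him.symm
    refine ⟨‖w‖, w.arg, norm_nonneg _, Complex.arg_nonneg_iff.2 h1, ?_, hx⟩
    by_contra! hlt
    have hw : 0 < ‖w‖ := by
      rw [norm_pos_iff]
      rintro hw
      rw [hw, Complex.arg_zero] at hlt
      linarith
    have h3 : 0 < Real.sin (w.arg - ξ) :=
      Real.sin_pos_of_pos_of_lt_pi (by linarith) (by linarith [Complex.arg_le_pi w])
    rw [Real.sin_sub] at h3
    have h4 := mul_pos hw h3
    rw [← hre, ← him] at h2
    linarith

/-- The wedge of angle `ξ ∈ (0, π)` as a closed convex cone. -/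
def wedgeCone (ξ : ℝ) (hξ0 : 0 < ξ) (hξπ : ξ < Real.pi) :
    ProperCone ℝ (EuclideanSpace ℝ (Fin 2)) where
  carrier := wedge ξ
  zero_mem' := by simp [mem_wedge_iff hξ0 hξπ]
  add_mem' {x y} hx hy := by
    rw [mem_wedge_iff hξ0 hξπ] at *
    simp only [PiLp.add_apply]
    constructor <;> linarith
  smul_mem' c x hx := by
    rw [mem_wedge_iff hξ0 hξπ] at *
    have h1 : (c • x) 0 = c * x 0 := rfl
    have h2 : (c • x) 1 = c * x 1 := rfl
    rw [h1, h2]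
    refine ⟨mul_nonneg c.2 hx.1, ?_⟩
    have := mul_nonneg c.2 hx.2
    linarith
  isClosed' := by
    have h : wedge ξ = {x | 0 ≤ x 1} ∩ {x | 0 ≤ x 0 * Real.sin ξ - x 1 * Real.cos ξ} :=
      Set.ext (mem_wedge_iff hξ0 hξπ)
    change IsClosed (wedge ξ)
    rw [h]
    exact (isClosed_le (by fun_prop) (by fun_prop)).inter (isClosed_le (by fun_prop) (by fun_prop))

theorem smul_direction_mem_interior_wedge {ξ η r : ℝ} (hξπ : ξ < Real.pi) (hη0 : 0 < η)
    (hηξ : η < ξ) (hr : 0 < r) :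
    r • !₂[Real.cos η, Real.sin η] ∈ interior (wedge ξ) := by
  refine mem_interior.2 ⟨{x | 0 < x 1} ∩ {x | 0 < x 0 * Real.sin ξ - x 1 * Real.cos ξ}, ?_, ?_, ?_⟩
  · exact fun x hx ↦ (mem_wedge_iff (hη0.trans hηξ) hξπ x).2 ⟨hx.1.le, hx.2.le⟩
  · exact (isOpen_lt (by fun_prop) (by fun_prop)).inter (isOpen_lt (by fun_prop) (by fun_prop))
  · have h1 := Real.sin_pos_of_pos_of_lt_pi hη0 (hηξ.trans hξπ)
    have h2 := Real.sin_pos_of_pos_of_lt_pi (sub_pos.2 hηξ) (by linarith)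
    rw [Real.sin_sub] at h2
    refine ⟨by simpa using mul_pos hr h1, ?_⟩
    have h3 := mul_pos hr h2
    simp
    linarith

theorem mainTheorem12 {Ω : Type*} [MeasurableSpace Ω] (P : Measure Ω) [IsProbabilityMeasure P]
    (B : ℝ≥0 → Ω → EuclideanSpace ℝ (Fin 2)) (hB : IsStandardBrownianMotion B P)
    (ξ η : ℝ) (hξ0 : 0 < ξ) (hξπ : ξ < Real.pi) (hη0 : 0 < η) (hηξ : η < ξ)
    (μ : EuclideanSpace ℝ (Fin 2)) (hμ0 : μ ≠ 0)
    (hμ : μ = ‖μ‖ • !₂[Real.cos η, Real.sin η])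
    (z : EuclideanSpace ℝ (Fin 2)) (hz : z ∈ interior (wedge ξ)) :
    NullMeasurableSet {ω | ∀ t : ℝ≥0, z + B t ω + (t : ℝ) • μ ∈ interior (wedge ξ)} P ∧
      0 < P {ω | ∀ t : ℝ≥0, z + B t ω + (t : ℝ) • μ ∈ interior (wedge ξ)} := by
  refine ⟨nullMeasurableSet_forall_mem_of_isOpen (X := fun t ω ↦ z + B t ω + (t : ℝ) • μ)
    (fun t ↦ ?_) ?_ isOpen_interior, ?_⟩
  · exact ((hB.aemeasurable t).const_add z).add_const _
  · filter_upwards [hB.ae_continuous] with ω hω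
    fun_prop
  · refine hB.measure_forall_mem_interior_pos (wedgeCone ξ hξ0 hξπ) ?_ hz
    rw [hμ]
    exact smul_direction_mem_interior_wedge hξπ hη0 hηξ (norm_pos_iff.2 hμ0)
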